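/- A standard Borel space is a measurable space isomorphic to the Borel space of a complete separable metric space. Let $X$ be a standard Borel space and let $E$ be a countable Borel equivalence relation on $X$, that is, an equivalence relation which is a Borel subset of $X\times X$ and all of whose equivalence classes are countable. Let $\pi\colon X\to X/E$ be the quotient projection and let $\mathbf{Bor}(X/E)=\{A\subseteq X/E : \pi^{-1}[A]\text{ is Borel in }X\}$ be the quotient $\sigma$-algebra. Then the following statements are equivalent: 1. $E$ is smooth, i.e. there are a standard Borel space $Y$ and a Borel map $f\colon X\to Y$ such that, for all $x,y\in X$, $x\mathrel{E}y$ if and only if $f(x)=f(y)$; 2. the $\sigma$-algebra $\mathbf{Bor}(X/E)$ is countably generated; 3. $(X/E,\mathbf{Bor}(X/E))$ is a standard Borel space. -/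

import Mathlib

universe u v

/-- A Borel equivalence relation on a measurable space `X`: an equivalence relation which is
Borel (measurable) as a subset of `X × X`. -/
def IsBorelEquivRel {X : Type u} [MeasurableSpace X] (E : Setoid X) : Prop :=
  MeasurableSet {p : X × X | E p.1 p.2}

/-- A countable equivalence relation: all its equivalence classes are countable. -/
def IsCountableEquivRel {X : Type u} (E : Setoid X) : Prop :=
  ∀ x : X, {y : X | E x y}.Countable

/-- `f` is a Borel reduction of `E` to `F`: a Borel map with `x E y ↔ f x F f y`. -/
def IsBorelReduction {X : Type u} {Y : Type v} [MeasurableSpace X] [MeasurableSpace Y]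
    (E : Setoid X) (F : Setoid Y) (f : X → Y) : Prop :=
  Measurable f ∧ ∀ x y : X, E x y ↔ F (f x) (f y)

/-- `E` is smooth if it is Borel reducible to the equality relation (the setoid `⊥`) on some
standard Borel space `Y`. -/
def IsSmoothEquivRel {X : Type u} [MeasurableSpace X] (E : Setoid X) : Prop :=
  ∃ (Y : Type v) (_ : MeasurableSpace Y) (_ : StandardBorelSpace Y) (f : X → Y),
    IsBorelReduction E (⊥ : Setoid Y) f

open MeasureTheory Set Function TopologicalSpace Filter
open scoped Topology ENNReal

/-! Smooth implies standard: a reduction `f` is countable-to-one, so by Lusin–Novikov it sends Borel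
sets to Borel sets, and the injection it induces on `X/E` is a Borel embedding. Conversely, classes
are countable, hence Borel, so a countably generated quotient embeds measurably in Cantor space.
Lusin–Novikov is proved by contraposition: if `X` is not a countable union of Borel sets on which
`f` is injective, a Cantor scheme is built whose sets at each level all meet a common fibre; in the
limit one fibre contains a Cantor set. -/

theorem MeasureTheory.AnalyticSet.inter {X : Type*} [TopologicalSpace X] [T2Space X]
    {A B : Set X} (hA : AnalyticSet A) (hB : AnalyticSet B) : AnalyticSet (A ∩ B) := by
  rw [inter_eq_iInter]
  exact AnalyticSet.iInter fun b ↦ by cases b <;> assumption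

/-! ### Enlarging analytic injectivity sets to Borel ones -/

section Reflection

variable {X Y : Type*} [TopologicalSpace X] [PolishSpace X] [MeasurableSpace X] [BorelSpace X]
  [TopologicalSpace Y] [T2Space Y] {f : X → Y}

/-- The points which share their fibre with a different point of an analytic set form an
analytic set. -/
theorem MeasureTheory.AnalyticSet.setOf_exists_ne_eq {A : Set X} (hA : AnalyticSet A)
    (hf : Continuous f) : AnalyticSet {x | ∃ x' ∈ A, x ≠ x' ∧ f x = f x'} := by
  have h1 : AnalyticSet (Prod.snd ⁻¹' A : Set (X × X)) := hA.preimage continuous_snd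
  have h2 : MeasurableSet ({p : X × X | p.1 ≠ p.2} ∩ {p : X × X | f p.1 = f p.2}) :=
    (isClosed_eq continuous_fst continuous_snd).isOpen_compl.measurableSet.inter
      (isClosed_eq (hf.comp continuous_fst) (hf.comp continuous_snd)).measurableSet
  have h3 := (h1.inter h2.analyticSet).image_of_continuous continuous_fst
  convert h3 using 1
  ext x
  constructor
  · rintro ⟨x', h, h'⟩
    exact ⟨(x, x'), ⟨h, h'⟩, rfl⟩
  · rintro ⟨⟨a, x'⟩, ⟨h, h'⟩, rfl⟩
    exact ⟨x', h, h'⟩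

/-- An analytic set on which a continuous map is injective is contained in a Borel set on which
the map is injective. -/
theorem MeasureTheory.AnalyticSet.exists_measurableSet_injOn {A : Set X} (hA : AnalyticSet A)
    (hf : Continuous f) (hinj : InjOn f A) : ∃ B, A ⊆ B ∧ MeasurableSet B ∧ InjOn f B := by
  obtain ⟨B₁, hAB₁, hB₁, mB₁⟩ := hA.measurablySeparable (hA.setOf_exists_ne_eq hf) <| by
    rw [disjoint_left]
    rintro x hx ⟨x', hx', hne, he⟩
    exact hne (hinj hx hx' he)
  -- Two points of `B₁` may still share a fibre, though neither can then lie in `A`; a second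
  -- separation removes such points.
  obtain ⟨B₂, hAB₂, hB₂, mB₂⟩ :=
    hA.measurablySeparable (mB₁.analyticSet.setOf_exists_ne_eq hf) <| by
    rw [disjoint_left]
    rintro x hx ⟨x', hx', hne, he⟩
    exact disjoint_left.1 hB₁ ⟨x, hx, hne.symm, he.symm⟩ hx'
  refine ⟨B₁ ∩ B₂, subset_inter hAB₁ hAB₂, mB₁.inter mB₂, fun x hx x' hx' he ↦ ?_⟩
  by_contra hne
  exact disjoint_left.1 hB₂ ⟨x', hx'.1, hne, he⟩ hx.2

end Reflection

/-- `Z` is a countable union of measurable sets on each of which `f` is injective. -/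
def IsCountableInjUnion {X Y : Type*} [MeasurableSpace X] (f : X → Y) (Z : Set X) : Prop :=
  ∃ C : Set (Set X), C.Countable ∧ (∀ B ∈ C, MeasurableSet B ∧ InjOn f B) ∧ ⋃₀ C = Z

section IsCountableInjUnion

variable {X Y : Type*} [MeasurableSpace X] {f : X → Y}

theorem IsCountableInjUnion.measurableSet {Z : Set X} (hZ : IsCountableInjUnion f Z) :
    MeasurableSet Z := by
  obtain ⟨C, hC, h, rfl⟩ := hZ
  exact .sUnion hC fun B hB ↦ (h B hB).1

theorem IsCountableInjUnion.empty : IsCountableInjUnion f ∅ :=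
  ⟨∅, countable_empty, by simp, by simp⟩

theorem IsCountableInjUnion.union_injOn {Z B : Set X} (hZ : IsCountableInjUnion f Z)
    (hB : MeasurableSet B) (hinj : InjOn f B) : IsCountableInjUnion f (Z ∪ B) := by
  obtain ⟨C, hC, h, rfl⟩ := hZ
  refine ⟨insert B C, hC.insert B, ?_, by rw [sUnion_insert, union_comm]⟩
  rintro B' (rfl | hB')
  exacts [⟨hB, hinj⟩, h B' hB']

theorem IsCountableInjUnion.biUnion {κ : Type*} {Q : Set κ} (hQ : Q.Countable) {Z : κ → Set X}
    (hZ : ∀ q ∈ Q, IsCountableInjUnion f (Z q)) : IsCountableInjUnion f (⋃ q ∈ Q, Z q) := by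
  choose! C hC h hCZ using hZ
  refine ⟨⋃ q ∈ Q, C q, hQ.biUnion hC, ?_, ?_⟩
  · intro B hB
    obtain ⟨q, hq, hB⟩ := mem_iUnion₂.1 hB
    exact h q hq B hB
  · simp only [sUnion_iUnion]
    exact iUnion₂_congr hCZ

end IsCountableInjUnion

/-- After the removal of any countable union of measurable sets on which `f` is injective,
some fibre of `f` still meets all members of the family `U`. -/
def IsFibrewiseLarge {X Y ι : Type*} [MeasurableSpace X] (f : X → Y) (U : ι → Set X) : Prop :=
  ∀ Z, IsCountableInjUnion f Z → ∃ y, ∀ i, ∃ x ∈ U i \ Z, f x = y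

theorem IsFibrewiseLarge.comp {X Y ι κ : Type*} [MeasurableSpace X] {f : X → Y} {U : ι → Set X}
    (hU : IsFibrewiseLarge f U) (g : κ → ι) : IsFibrewiseLarge f (U ∘ g) := fun Z hZ ↦
  (hU Z hZ).imp fun _ h k ↦ h (g k)

/-- `P` consists of two disjoint open sets of diameter at most `ε` with closures inside `U`. -/
structure IsSplitting {X : Type*} [PseudoEMetricSpace X] (ε : ℝ≥0∞) (U : Set X)
    (P : Bool → Set X) : Prop where
  isOpen : ∀ b, IsOpen (P b)
  closure_subset : ∀ b, closure (P b) ⊆ U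
  ediam_le : ∀ b, Metric.ediam (P b) ≤ ε
  disjoint : Disjoint (P true) (P false)

theorem TopologicalSpace.IsTopologicalBasis.exists_mem_closure_subset_ediam_le {X : Type*}
    [PseudoEMetricSpace X] {b : Set (Set X)} (hb : IsTopologicalBasis b) {O : Set X} (hO : IsOpen O)
    {x : X} (hx : x ∈ O) {ε : ℝ≥0∞} (hε : 0 < ε) :
    ∃ B ∈ b, x ∈ B ∧ closure B ⊆ O ∧ Metric.ediam B ≤ ε := by
  obtain ⟨t, ht, htc, htO⟩ := exists_mem_nhds_isClosed_subset (hO.mem_nhds hx)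
  have hε' : 0 < ε / 2 := ENNReal.half_pos hε.ne'
  obtain ⟨B, hB, hxB, hBt⟩ := hb.mem_nhds_iff.1
    (inter_mem ht (Metric.eball_mem_nhds x hε'))
  refine ⟨B, hB, hxB, (closure_minimal (hBt.trans inter_subset_left) htc).trans htO, ?_⟩
  refine (Metric.ediam_mono (hBt.trans inter_subset_right)).trans (Metric.ediam_eball_le.trans ?_)
  rw [ENNReal.mul_div_cancel (by norm_num) (by norm_num)]

/-! ### The Cantor scheme over a single fibre -/

section Splitting

variable {X Y : Type*} [MetricSpace X] [PolishSpace X] [MeasurableSpace X] [BorelSpace X]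
  [TopologicalSpace Y] [T2Space Y] {f : X → Y}

/-- If every splitting by basic open sets fails, the countably many witnesses have a union `Z'` that
is still removable. What remains of `U k` over fibres still meeting every `U j` is analytic with `f`
injective on it; reflection makes it removable too, against largeness. -/
theorem IsFibrewiseLarge.exists_isSplitting {κ : Type*} [Countable κ] (hf : Continuous f)
    {U : κ → Set X} (hU : IsFibrewiseLarge f U) (hUo : ∀ k, IsOpen (U k)) (k : κ) {ε : ℝ≥0∞}
    (hε : 0 < ε) : ∃ P, IsSplitting ε (U k) P ∧ IsFibrewiseLarge f (Sum.elim U P) := by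
  by_contra! hcon
  let Q : Set (Bool → Set X) :=
    {P | ∀ b, P b ∈ countableBasis X} ∩ {P | IsSplitting ε (U k) P}
  have hQ : Q.Countable :=
    (countable_pi fun _ ↦ countable_countableBasis X).mono inter_subset_left
  have hQZ : ∀ P ∈ Q, ∃ Z, IsCountableInjUnion f Z ∧
      ¬ ∃ y, ∀ i, ∃ x ∈ Sum.elim U P i \ Z, f x = y := by
    intro P hP
    simpa only [IsFibrewiseLarge, not_forall, exists_prop] using hcon P hP.2
  choose! Z hZ hZn using hQZ
  have hZQ := IsCountableInjUnion.biUnion hQ hZ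
  set Z' := ⋃ P ∈ Q, Z P
  have hUZ : ∀ j, AnalyticSet (U j \ Z') := fun j ↦
    ((hUo j).measurableSet.diff hZQ.measurableSet).analyticSet
  let A := (U k \ Z') ∩ f ⁻¹' ⋂ j, f '' (U j \ Z')
  have : Nonempty κ := ⟨k⟩
  have hA : AnalyticSet A := (hUZ k).inter <|
    (AnalyticSet.iInter fun j ↦ (hUZ j).image_of_continuous hf).preimage hf
  have hinj : InjOn f A := by
    intro x hx x' hx' he
    by_contra hne
    obtain ⟨O, O', hO, hO', hxO, hxO', hd⟩ := t2_separation hne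
    obtain ⟨B, hB, hxB, hcB, hdB⟩ :=
      (isBasis_countableBasis X).exists_mem_closure_subset_ediam_le
        (hO.inter (hUo k)) ⟨hxO, hx.1.1⟩ hε
    obtain ⟨B', hB', hxB', hcB', hdB'⟩ :=
      (isBasis_countableBasis X).exists_mem_closure_subset_ediam_le
        (hO'.inter (hUo k)) ⟨hxO', hx'.1.1⟩ hε
    have hP : (fun b ↦ bif b then B else B') ∈ Q := by
      refine ⟨by rintro (_ | _) <;> assumption, ?_, ?_, ?_, ?_⟩
      · rintro (_ | _)
        exacts [isOpen_of_mem_countableBasis hB', isOpen_of_mem_countableBasis hB]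
      · rintro (_ | _)
        exacts [hcB'.trans inter_subset_right, hcB.trans inter_subset_right]
      · rintro (_ | _) <;> assumption
      · exact hd.mono (subset_closure.trans (hcB.trans inter_subset_left))
          (subset_closure.trans (hcB'.trans inter_subset_left))
    have hsub : Z (fun b ↦ bif b then B else B') ⊆ Z' := subset_biUnion_of_mem hP
    refine hZn _ hP ⟨f x, ?_⟩
    rintro (j | _ | _)
    · obtain ⟨z, hz, hzx⟩ := mem_iInter.1 hx.2 j
      exact ⟨z, ⟨hz.1, fun h ↦ hz.2 (hsub h)⟩, hzx⟩
    · exact ⟨x', ⟨hxB', fun h ↦ hx'.1.2 (hsub h)⟩, he.symm⟩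
    · exact ⟨x, ⟨hxB, fun h ↦ hx.1.2 (hsub h)⟩, rfl⟩
  obtain ⟨B, hAB, mB, hB⟩ := hA.exists_measurableSet_injOn hf hinj
  obtain ⟨y, hy⟩ := hU _ (hZQ.union_injOn mB hB)
  obtain ⟨x, hx, rfl⟩ := hy k
  refine hx.2 (Or.inr (hAB ⟨⟨hx.1, fun h ↦ hx.2 (Or.inl h)⟩, mem_iInter.2 fun j ↦ ?_⟩))
  obtain ⟨z, hz, hzx⟩ := hy j
  exact ⟨z, ⟨hz.1, fun h ↦ hz.2 (Or.inl h)⟩, hzx⟩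

/-- Members are split one at a time; those not yet split appear as two equal copies, which keeps the
index type fixed. -/
theorem IsFibrewiseLarge.exists_forall_isSplitting {ι : Type*} [Finite ι] (hf : Continuous f)
    {U : ι → Set X} (hU : IsFibrewiseLarge f U) (hUo : ∀ i, IsOpen (U i)) {ε : ℝ≥0∞}
    (hε : 0 < ε) :
    ∃ V : ι → Bool → Set X, (∀ i, IsSplitting ε (U i) (V i)) ∧ IsFibrewiseLarge f (uncurry V) := by
  classical
  have := Fintype.ofFinite ι
  suffices h : ∀ s : Finset ι, ∃ V : ι → Bool → Set X, (∀ i ∈ s, IsSplitting ε (U i) (V i)) ∧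
      (∀ i ∉ s, ∀ b, V i b = U i) ∧ IsFibrewiseLarge f (uncurry V) by
    obtain ⟨V, hV, -, hVl⟩ := h Finset.univ
    exact ⟨V, fun i ↦ hV i (Finset.mem_univ i), hVl⟩
  intro s
  induction s using Finset.induction_on with
  | empty => exact ⟨fun i _ ↦ U i, by simp, by simp, hU.comp Prod.fst⟩
  | insert i s hi ih =>
    obtain ⟨V, hVs, hVn, hV⟩ := ih
    have hVo : ∀ p, IsOpen (uncurry V p) := by
      rintro ⟨j, b⟩
      by_cases hj : j ∈ s
      · exact (hVs j hj).isOpen b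
      · simpa [uncurry, hVn j hj] using hUo j
    obtain ⟨P, hP, hPl⟩ := hV.exists_isSplitting hf hVo (i, true) hε
    have hPU : IsSplitting ε (U i) P := by simpa [uncurry, hVn i hi] using hP
    refine ⟨update V i P, fun j hj ↦ ?_, fun j hj b ↦ ?_, ?_⟩
    · rcases eq_or_ne j i with rfl | hji
      · simpa using hPU
      · simpa [hji] using hVs j (Finset.mem_of_mem_insert_of_ne hj hji)
    · rw [Finset.mem_insert, not_or] at hj
      simpa [hj.1] using hVn j hj.2 b
    · convert hPl.comp fun p : ι × Bool ↦ if p.1 = i then Sum.inr p.2 else Sum.inl p using 1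
      ext1 ⟨j, b⟩
      by_cases hji : j = i
      · subst hji; simp [uncurry]
      · simp [uncurry, hji]

/-- A continuous map on a Polish space is injective on each of countably many measurable sets
covering the space, or one of its fibres contains a copy of the Cantor space. -/
theorem Continuous.exists_injective_fibre_of_not_isCountableInjUnion (hf : Continuous f)
    [CompleteSpace X] (h : ¬ IsCountableInjUnion f univ) :
    ∃ (g : (ℕ → Bool) → X) (y : Y), Injective g ∧ ∀ a, f (g a) = y := by
  let S (n : ℕ) := {U : List.Vector Bool n → Set X // (∀ v, IsOpen (U v)) ∧ IsFibrewiseLarge f U}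
  -- At `n = 0` the bound is `∞`, so the first splitting is unconstrained.
  have hε (n : ℕ) : (0 : ℝ≥0∞) < (n : ℝ≥0∞)⁻¹ := ENNReal.inv_pos.2 (ENNReal.natCast_ne_top n)
  have step (n : ℕ) (U : S n) : ∃ V : S (n + 1),
      ∀ v, IsSplitting (n : ℝ≥0∞)⁻¹ (U.1 v) fun b ↦ V.1 (b ::ᵥ v) := by
    obtain ⟨V, hV, hVl⟩ := U.2.2.exists_forall_isSplitting hf U.2.1 (hε n)
    refine ⟨⟨fun v ↦ V v.tail v.head, fun v ↦ (hV _).isOpen _,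
      hVl.comp fun v : List.Vector Bool (n + 1) ↦ (v.tail, v.head)⟩, fun v ↦ ?_⟩
    simpa using hV v
  choose next hnext using step
  have h0 : IsFibrewiseLarge f fun _ : List.Vector Bool 0 ↦ (univ : Set X) := by
    intro Z hZ
    obtain ⟨x, hx⟩ : ∃ x, x ∉ Z := by
      by_contra! hx
      exact h (eq_univ_of_forall hx ▸ hZ)
    exact ⟨f x, fun _ ↦ ⟨x, ⟨trivial, hx⟩, rfl⟩⟩
  let U : (n : ℕ) → S n := fun n ↦ Nat.rec ⟨_, fun _ ↦ isOpen_univ, h0⟩ next n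
  have hU (n : ℕ) (v : List.Vector Bool n) :
      IsSplitting (n : ℝ≥0∞)⁻¹ ((U n).1 v) fun b ↦ (U (n + 1)).1 (b ::ᵥ v) := hnext n (U n) v
  let A : List Bool → Set X := fun l ↦ (U l.length).1 ⟨l, rfl⟩
  have hA (l : List Bool) : IsSplitting (l.length : ℝ≥0∞)⁻¹ (A l) fun b ↦ A (b :: l) :=
    hU l.length ⟨l, rfl⟩
  have hanti : CantorScheme.ClosureAntitone A := fun l b ↦ (hA l).closure_subset b
  have hdisj : CantorScheme.Disjoint A := by
    rintro l (_ | _) (_ | _) hab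
    exacts [(hab rfl).elim, (hA l).disjoint.symm, (hA l).disjoint, (hab rfl).elim]
  have hdiam : CantorScheme.VanishingDiam A := by
    intro a
    rw [← tendsto_add_atTop_iff_nat 1]
    refine tendsto_of_tendsto_of_tendsto_of_le_of_le tendsto_const_nhds
      ENNReal.tendsto_inv_nat_nhds_zero (fun _ ↦ zero_le) fun n ↦ ?_
    simpa [PiNat.res_succ] using (hA (PiNat.res a n)).ediam_le (a n)
  choose y hy using fun n ↦ (U n).2.2 ∅ .empty
  have hAy (l : List Bool) : ∃ x ∈ A l, f x = y l.length := by
    simpa using hy l.length ⟨l, rfl⟩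
  have hdom := hanti.map_of_vanishingDiam hdiam fun l ↦ (hAy l).imp fun _ h ↦ h.1
  let g : (ℕ → Bool) → X := fun a ↦ (CantorScheme.inducedMap A).2 ⟨a, hdom ▸ mem_univ a⟩
  -- The value `y n` serves all words of length `n`, so every branch has the same limit under `f`.
  have hlim (a : ℕ → Bool) : Tendsto y atTop (𝓝 (f (g a))) := by
    choose x hxA hxy using fun n ↦ hAy (PiNat.res a n)
    have hx : Tendsto x atTop (𝓝 (g a)) := by
      rw [tendsto_iff_edist_tendsto_0]
      exact tendsto_of_tendsto_of_tendsto_of_le_of_le tendsto_const_nhds (hdiam a)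
        (fun _ ↦ zero_le) fun n ↦ Metric.edist_le_ediam_of_mem (hxA n)
          (CantorScheme.map_mem (A := A) ⟨a, hdom ▸ mem_univ a⟩ n)
    refine ((hf.tendsto _).comp hx).congr fun n ↦ ?_
    simpa using hxy n
  refine ⟨g, f (g default), fun a b hab ↦ ?_, fun a ↦ tendsto_nhds_unique (hlim a) (hlim _)⟩
  exact congrArg Subtype.val (hdisj.map_injective hab)

end Splitting

/-- **Lusin–Novikov**: a countable-to-one Borel map between standard Borel spaces is injective on
each of countably many Borel sets covering its domain. -/
theorem Measurable.isCountableInjUnion_univ {X Y : Type*} [MeasurableSpace X] [StandardBorelSpace X]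
    [MeasurableSpace Y] [StandardBorelSpace Y] {f : X → Y} (hf : Measurable f)
    (hc : ∀ y, (f ⁻¹' {y}).Countable) : IsCountableInjUnion f univ := by
  obtain ⟨t, ht, htp⟩ := StandardBorelSpace.polish (α := X)
  let := upgradeStandardBorel Y
  -- A finer Polish topology makes `f` continuous without changing the Borel sets.
  obtain ⟨t', hle, hft', htp'⟩ := hf.exists_continuous
  have hb : @BorelSpace X t' _ := @BorelSpace.mk X t' _ <|
    ht.measurable_eq.trans (borel_eq_borel_of_le htp' htp hle).symm
  clear! t
  let := upgradeIsCompletelyMetrizable X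
  by_contra h
  obtain ⟨g, y, hg, hgy⟩ := hft'.exists_injective_fibre_of_not_isCountableInjUnion h
  have : Countable (f ⁻¹' {y}) := (hc y).to_subtype
  have : Countable (ℕ → Bool) :=
    Injective.countable (f := fun a ↦ (⟨g a, hgy a⟩ : f ⁻¹' {y})) fun a b hab ↦
      hg (congrArg Subtype.val hab)
  obtain ⟨e, he⟩ := exists_surjective_nat (ℕ → Bool)
  obtain ⟨n, hn⟩ := he fun k ↦ !e k k
  simpa using congrFun hn n

/-- A countable-to-one Borel map between standard Borel spaces maps Borel sets to Borel sets. -/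
theorem MeasurableSet.image_of_countable_fibres {X Y : Type*} [MeasurableSpace X]
    [StandardBorelSpace X] [MeasurableSpace Y] [StandardBorelSpace Y] {f : X → Y} {s : Set X}
    (hs : MeasurableSet s) (hf : Measurable f) (hc : ∀ y, (f ⁻¹' {y}).Countable) :
    MeasurableSet (f '' s) := by
  obtain ⟨C, hC, hCf, hCu⟩ := hf.isCountableInjUnion_univ hc
  rw [← inter_univ s, ← hCu, sUnion_eq_biUnion, inter_iUnion₂, image_iUnion₂]
  exact .biUnion hC fun B hB ↦
    (hs.inter (hCf B hB).1).image_of_measurable_injOn hf ((hCf B hB).2.mono inter_subset_right)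

theorem MeasurableEmbedding.standardBorelSpace {X Y : Type*} [MeasurableSpace X]
    [MeasurableSpace Y] [StandardBorelSpace Y] {f : X → Y} (hf : MeasurableEmbedding f) :
    StandardBorelSpace X := by
  have := hf.measurableSet_range.standardBorel
  obtain ⟨t, ht, htp⟩ := StandardBorelSpace.polish (α := range f)
  let e := hf.equivRange
  let t' : TopologicalSpace X := t.induced e
  have he : @Topology.IsInducing X _ t' t e := ⟨rfl⟩
  refine ⟨t', ⟨?_⟩, (e.toEquiv.toHomeomorphOfIsInducing he).isClosedEmbedding.polishSpace⟩
  exact e.measurableEmbedding.comap_eq.symm.trans <|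
    (congrArg (MeasurableSpace.comap e) ht.measurable_eq).trans borel_comap.symm

theorem mainTheorem8 {X : Type u} [MeasurableSpace X] [StandardBorelSpace X] (E : Setoid X)
    (hBorel : IsBorelEquivRel E) (hCountable : IsCountableEquivRel E) :
    List.TFAE
      [IsSmoothEquivRel.{u, v} E,
       @MeasurableSpace.CountablyGenerated (Quotient E) Quotient.instMeasurableSpace,
       @StandardBorelSpace (Quotient E) Quotient.instMeasurableSpace] := by
  tfae_have 1 → 3 := by
    rintro ⟨Y, _, _, f, hf, hfE⟩
    have hfE' : ∀ x y, E x y ↔ f x = f y := hfE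
    have hc : ∀ y, (f ⁻¹' {y}).Countable := fun y ↦ by
      rcases (f ⁻¹' {y}).eq_empty_or_nonempty with h | ⟨x, rfl⟩
      · simp [h]
      · exact (hCountable x).mono fun z hz ↦ (hfE' x z).2 hz.symm
    let g : Quotient E → Y := Quotient.lift f fun x y h ↦ (hfE' x y).1 h
    have hg : MeasurableEmbedding g := by
      refine ⟨?_, measurable_from_quotient.2 hf, fun s hs ↦ ?_⟩
      · rintro ⟨x⟩ ⟨y⟩ h
        exact Quotient.sound ((hfE' x y).2 h)
      · have : g '' s = f '' (Quotient.mk E ⁻¹' s) := by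
          conv_lhs => rw [← image_preimage_eq s Quotient.mk_surjective, image_image]
          rfl
        rw [this]
        exact MeasurableSet.image_of_countable_fibres hs hf hc
    exact hg.standardBorelSpace
  tfae_have 3 → 2 := fun _ ↦ inferInstance
  tfae_have 2 → 1 := by
    intro _
    -- Measurable singletons make the generating sequence separate points, so `mapNatBool` is
    -- injective.
    have : MeasurableSingletonClass (Quotient E) := by
      refine ⟨fun q ↦ ?_⟩
      induction q using Quotient.inductionOn with | h x => ?_
      refine ((hCountable x).mono fun y hy ↦ ?_).measurableSet
      exact E.symm (Quotient.exact hy)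
    refine ⟨ULift.{v} (ℕ → Bool), inferInstance,
      (MeasurableEquiv.ulift (α := ℕ → Bool)).measurableEmbedding.standardBorelSpace,
      fun x ↦ ⟨MeasurableSpace.mapNatBool _ (Quotient.mk E x)⟩, ?_, fun x y ↦ ?_⟩
    · exact (measurable_up.comp (MeasurableSpace.measurable_mapNatBool _)).comp
        measurable_quotient_mk'
    · refine Quotient.eq.symm.trans ⟨fun h ↦
        congrArg (fun q ↦ ULift.up (MeasurableSpace.mapNatBool _ q)) h, fun h ↦ ?_⟩
      exact MeasurableSpace.injective_mapNatBool _ (ULift.up_injective h)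
  tfae_finish
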